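/- A \emph{rooted labelled tree} with $n \ge 1$ nodes is a pair $(G,r)$ consisting of a tree $G$ on the vertex set $\{1,\dots,n\}$ and a vertex $r$ of $G$, the root. A vertex $v$ is a \emph{record} of $(G,r)$ if its label is the largest among the labels on the unique path from $r$ to $v$ (so the root is always a record). Let $R_\bullet(n,k)$ be the number of rooted labelled trees with $n$ nodes and exactly $k$ records (with $R_\bullet(0,k)=0$), and let $\mathcal T(z)=\sum_{n\ge 1} n^{n-1}\frac{z^n}{n!}$ be the Cayley tree function. Then for every integer $j\ge 1$, as formal power series in $z$ with coefficients in $\mathbb R[t]$, $$\sum_{n\ge 0} R_\bullet(n,j)\,t^j\,\frac{z^n}{n!} \;=\; \int_0^z \frac{1}{s}\,\bigl(t\,\mathcal T(s)\bigr)^j\,ds .$$ Here $(t\,\mathcal T(s))^j$ is divisible by $s$ in $\mathbb R[t][[s]]$, $\frac1s (t\,\mathcal T(s))^j$ denotes the quotient, and the integral is the formal one, $\int_0^z s^n\,ds = \frac{z^{n+1}}{n+1}$. -/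

import Mathlib

namespace TreeRecords

open Polynomial

/-- The vertex `v` of the tree `G` rooted at `r` is a record: its label is the largest one along
the (unique) path from the root `r` to `v`. -/
def IsRecord {V : Type*} [LinearOrder V] (G : SimpleGraph V) (r v : V) : Prop :=
  ∀ p : G.Walk r v, p.IsPath → ∀ w ∈ p.support, w ≤ v

/-- The tree record number: the number of rooted labelled trees with `n` nodes (pairs of a tree
on the ordered label set `Fin n` and a root) that have exactly `k` records. -/
noncomputable def treeRecordNumber (n k : ℕ) : ℕ :=
  {P : SimpleGraph (Fin n) × Fin n |
    P.1.IsTree ∧ {v : Fin n | IsRecord P.1 P.2 v}.ncard = k}.ncard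

/-- The Cayley tree function `∑_{n ≥ 1} n ^ (n - 1) z ^ n / n!`, as a power series in `z` over
the polynomials `ℝ[t]`. -/
noncomputable def cayleyTreeFunction : PowerSeries ℝ[X] :=
  PowerSeries.mk fun n =>
    if n = 0 then 0 else C ((n : ℝ) ^ (n - 1) / (n.factorial : ℝ))

/-- The exponential generating function of rooted labelled trees with exactly `j` records, where
`z` marks nodes and `t` marks records: `∑_n R(n, j) t ^ j z ^ n / n!`. -/
noncomputable def treeRecordSeries (j : ℕ) : PowerSeries ℝ[X] :=
  PowerSeries.mk fun n => monomial j ((treeRecordNumber n j : ℝ) / (n.factorial : ℝ))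

/-- The formal integral `∫₀^z g(s) ds`, sending `∑ a_n s ^ n` to `∑ a_n z ^ (n + 1) / (n + 1)`. -/
noncomputable def formalIntegral (g : PowerSeries ℝ[X]) : PowerSeries ℝ[X] :=
  PowerSeries.mk fun
    | 0 => 0
    | n + 1 => ((n : ℝ) + 1)⁻¹ • PowerSeries.coeff n g

end TreeRecords

/-! Let `m` be the largest label. If the root is `m`, it is the only record, so trees with one
record are counted by unrooted trees (`treeRecordNumber_one`). Otherwise let `A` be the set of
vertices reachable from the root without meeting `m`. Exactly one edge leaves `A`, from some `p ∈ A`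
to `m`. The tree thus amounts to a rooted tree on `A`, a point `p` of `A`, and a tree on `Aᶜ`, which
needs no further marking since its attaching vertex is `m`. Beyond `m` nothing is a record, so the
records are `m` and those of the tree on `A`.

Summing over `A` gives `treeRecordNumber_succ_succ`. Write `F_j` for the series of trees with `j`
records and `𝒯` for the tree function; marking `p` turns `F_j` into `z F_j'`, so the recurrence
reads `z F_{j+1}' = z F_j' · t𝒯`. Hence `z F_j' = (t𝒯)^j`, and integration finishes.

That `𝒯` has the coefficients `n^(n-1)/n!` is Cayley's formula (`treeCount_mul`): the same
decomposition, with records ignored, gives a recurrence that Abel's binomial identity solves. -/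

namespace TreeRecords

/-! ### Splitting a rooted tree at its largest label. -/

section GraphDecomposition

open SimpleGraph

/-- The graph `G` has exactly one edge between `A` and its complement, and it joins `p ∈ A` to
`m ∉ A`. -/
structure JoinedAt {V : Type*} (G : SimpleGraph V) (A : Set V) (p m : V) : Prop where
  left_mem : p ∈ A
  right_notMem : m ∉ A
  adj_iff : ∀ ⦃a⦄, a ∈ A → ∀ ⦃b⦄, b ∉ A → (G.Adj a b ↔ a = p ∧ b = m)

/-- The vertices that can be reached from `r` without visiting `m`. -/
def avoidSet {V : Type*} (G : SimpleGraph V) (r m : V) : Set V :=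
  {v | ∃ w : G.Walk r v, m ∉ w.support}

/-- The disjoint union of a graph on `A` and a graph on the complement of `A`, together with the
edge from `p` to `m`. -/
def glue {V : Type*} (A : Set V) (GA : SimpleGraph A) (GB : SimpleGraph ↥Aᶜ) (p m : V) :
    SimpleGraph V :=
  GA.map (Function.Embedding.subtype (· ∈ A)) ⊔
    GB.map (Function.Embedding.subtype (· ∈ Aᶜ)) ⊔ edge p m

section Glue

variable {V : Type*} {A : Set V} {GA : SimpleGraph A} {GB : SimpleGraph ↥Aᶜ} {p m : V}

theorem glue_adj {a b : V} : (glue A GA GB p m).Adj a b ↔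
    (∃ (ha : a ∈ A) (hb : b ∈ A), GA.Adj ⟨a, ha⟩ ⟨b, hb⟩) ∨
    (∃ (ha : a ∉ A) (hb : b ∉ A), GB.Adj ⟨a, ha⟩ ⟨b, hb⟩) ∨
    ((a = p ∧ b = m ∨ a = m ∧ b = p) ∧ a ≠ b) := by
  rw [glue, sup_adj, sup_adj, map_adj, map_adj, edge_adj, or_assoc]
  refine or_congr ?_ (or_congr ?_ Iff.rfl)
  · constructor
    · rintro ⟨u, v, h, rfl, rfl⟩
      exact ⟨u.2, v.2, h⟩
    · rintro ⟨ha, hb, h⟩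
      exact ⟨_, _, h, rfl, rfl⟩
  · constructor
    · rintro ⟨u, v, h, rfl, rfl⟩
      exact ⟨u.2, v.2, h⟩
    · rintro ⟨ha, hb, h⟩
      exact ⟨_, _, h, rfl, rfl⟩

theorem glue_joinedAt (hp : p ∈ A) (hm : m ∉ A) : JoinedAt (glue A GA GB p m) A p m where
  left_mem := hp
  right_notMem := hm
  adj_iff a ha b hb := by
    rw [glue_adj]
    constructor
    · rintro (⟨_, h, _⟩ | ⟨h, _⟩ | ⟨h | h, _⟩)
      · exact absurd h hb
      · exact absurd ha h
      · exact h
      · exact absurd (h.1 ▸ ha) hm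
    · rintro ⟨rfl, rfl⟩
      exact Or.inr (Or.inr ⟨Or.inl ⟨rfl, rfl⟩, fun h => hb (h ▸ ha)⟩)

theorem glue_induce_left (hm : m ∉ A) : (glue A GA GB p m).induce A = GA := by
  ext a b
  rw [comap_adj, glue_adj]
  constructor
  · rintro (⟨_, _, h⟩ | ⟨h, _⟩ | ⟨h | h, _⟩)
    · exact h
    · exact absurd a.2 h
    · exact absurd (h.2 ▸ b.2) hm
    · exact absurd (h.1 ▸ a.2) hm
  · exact fun h => Or.inl ⟨a.2, b.2, h⟩

theorem glue_induce_right (hp : p ∈ A) : (glue A GA GB p m).induce Aᶜ = GB := by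
  ext a b
  rw [comap_adj, glue_adj]
  constructor
  · rintro (⟨h, _⟩ | ⟨_, _, h⟩ | ⟨h | h, _⟩)
    · exact absurd h a.2
    · exact h
    · exact absurd hp (h.1 ▸ a.2)
    · exact absurd hp (h.2 ▸ b.2)
  · exact fun h => Or.inr (Or.inl ⟨a.2, b.2, h⟩)

theorem JoinedAt.glue_eq {G : SimpleGraph V} (h : JoinedAt G A p m) :
    glue A (G.induce A) (G.induce Aᶜ) p m = G := by
  ext a b
  rw [glue_adj]
  simp only [comap_adj, Function.Embedding.subtype_apply]
  by_cases ha : a ∈ A <;> by_cases hb : b ∈ A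
  · have h1 : a ≠ m := fun e => h.right_notMem (e ▸ ha)
    have h2 : b ≠ m := fun e => h.right_notMem (e ▸ hb)
    simp [ha, hb, h1, h2]
  · have h1 : a ≠ m := fun e => h.right_notMem (e ▸ ha)
    have h2 : a ≠ b := fun e => hb (e ▸ ha)
    simp [ha, hb, h1, h2, h.adj_iff ha hb]
  · have h1 : b ≠ m := fun e => h.right_notMem (e ▸ hb)
    have h2 : a ≠ b := fun e => ha (e ▸ hb)
    rw [G.adj_comm]
    simp [ha, hb, h1, h2, h.adj_iff hb ha, and_comm]
  · have h1 : a ≠ p := fun e => ha (e ▸ h.left_mem)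
    have h2 : b ≠ p := fun e => hb (e ▸ h.left_mem)
    simp [ha, hb, h1, h2]

theorem JoinedAt.connected {G : SimpleGraph V} (h : JoinedAt G A p m)
    (hA : (G.induce A).Connected) (hB : (G.induce Aᶜ).Connected) : G.Connected := by
  have hpm : G.Reachable p m :=
    ((h.adj_iff h.left_mem h.right_notMem).2 ⟨rfl, rfl⟩).reachable
  have key : ∀ v, G.Reachable p v := by
    intro v
    by_cases hv : v ∈ A
    · exact (hA ⟨p, h.left_mem⟩ ⟨v, hv⟩).map (Embedding.induce A).toHom
    · exact hpm.trans ((hB ⟨m, h.right_notMem⟩ ⟨v, hv⟩).map (Embedding.induce Aᶜ).toHom)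
  exact { preconnected := fun u v => (key u).symm.trans (key v), nonempty := ⟨p⟩ }

/-- By edge counting: the two trees and the joining edge have together at most `|V| - 1` edges, and
a connected graph with so few edges is a tree. -/
theorem glue_isTree [Finite V] (hp : p ∈ A) (hm : m ∉ A) (hA : GA.IsTree) (hB : GB.IsTree) :
    (glue A GA GB p m).IsTree := by
  have hJ : JoinedAt (glue A GA GB p m) A p m := glue_joinedAt hp hm
  have hconn : (glue A GA GB p m).Connected :=
    hJ.connected (by rw [glue_induce_left hm]; exact hA.connected)
      (by rw [glue_induce_right hp]; exact hB.connected)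
  refine isTree_iff_connected_and_card.2
    ⟨hconn, le_antisymm ?_ hconn.card_vert_le_card_edgeSet_add_one⟩
  have h1 := (isTree_iff_connected_and_card.1 hA).2
  have h2 := (isTree_iff_connected_and_card.1 hB).2
  have hpm : p ≠ m := fun e => hm (e ▸ hp)
  have h3 : A.ncard + Aᶜ.ncard = Nat.card V := Set.ncard_add_ncard_compl A
  rw [Nat.card_coe_set_eq] at h1 h2 ⊢
  rw [Nat.card_coe_set_eq] at h1 h2
  have h4 : (glue A GA GB p m).edgeSet.ncard ≤ GA.edgeSet.ncard + GB.edgeSet.ncard + 1 := by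
    rw [glue, edgeSet_sup, edgeSet_sup, edgeSet_map, edgeSet_map, edgeSet_edge_of_ne hpm]
    refine (Set.ncard_union_le _ _).trans (add_le_add ((Set.ncard_union_le _ _).trans
      (add_le_add (Set.ncard_image_le (Set.toFinite _)) (Set.ncard_image_le (Set.toFinite _)))) ?_)
    rw [Set.ncard_singleton]
  omega

end Glue

section Walks

variable {V : Type*} {A : Set V} {G : SimpleGraph V} {p m r : V}

/-- The only edge out of `A` ends at `m`, so a walk that misses `m` cannot leave. -/
theorem JoinedAt.support_subset (h : JoinedAt G A p m) {u v : V} (w : G.Walk u v) (hu : u ∈ A)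
    (hw : m ∉ w.support) : ∀ x ∈ w.support, x ∈ A := by
  induction w with
  | nil => simpa using hu
  | @cons u x v hux w ih =>
    rw [Walk.support_cons, List.mem_cons, not_or] at hw
    have hx : x ∈ A := by
      by_contra hx
      exact hw.2 (((h.adj_iff hu hx).1 hux).2 ▸ w.start_mem_support)
    intro y hy
    rw [Walk.support_cons, List.mem_cons] at hy
    rcases hy with rfl | hy
    · exact hu
    · exact ih hx hw.2 y hy

theorem exists_walk_of_walk_induce {u v : A} (w : (G.induce A).Walk u v) :
    ∃ q : G.Walk u v, ∀ x ∈ q.support, ∃ y ∈ w.support, (y : V) = x := by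
  refine ⟨w.map (Embedding.induce A).toHom, fun x hx => ?_⟩
  exact List.mem_map.1 ((Walk.support_map (Embedding.induce A).toHom w).subst hx)

theorem JoinedAt.avoidSet_eq (h : JoinedAt G A p m) (hA : (G.induce A).Preconnected)
    (hr : r ∈ A) : avoidSet G r m = A := by
  ext v
  constructor
  · rintro ⟨w, hw⟩
    exact h.support_subset w hr hw v w.end_mem_support
  · intro hv
    obtain ⟨w⟩ := hA ⟨r, hr⟩ ⟨v, hv⟩
    obtain ⟨q, hq⟩ := exists_walk_of_walk_induce w
    refine ⟨q, fun hmq => ?_⟩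
    obtain ⟨x, -, hx⟩ := hq m hmq
    exact h.right_notMem (hx ▸ x.2)

theorem notMem_avoidSet : m ∉ avoidSet G r m := fun ⟨w, hw⟩ => hw w.end_mem_support

theorem mem_avoidSet_self (hr : r ≠ m) : r ∈ avoidSet G r m := ⟨Walk.nil, by simpa using hr.symm⟩

theorem mem_avoidSet_of_walk {u v : V} (hu : u ∈ avoidSet G r m) (w : G.Walk u v)
    (hw : m ∉ w.support) : v ∈ avoidSet G r m := by
  obtain ⟨q, hq⟩ := hu
  refine ⟨q.append w, ?_⟩
  rw [Walk.mem_support_append_iff]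
  exact not_or.2 ⟨hq, hw⟩

theorem connected_induce_avoidSet (hr : r ≠ m) : (G.induce (avoidSet G r m)).Connected := by
  classical
  have key : ∀ v : avoidSet G r m,
      (G.induce (avoidSet G r m)).Reachable ⟨r, mem_avoidSet_self hr⟩ v := by
    rintro ⟨v, w, hw⟩
    refine ⟨w.induce (avoidSet G r m) fun x hx => ⟨w.takeUntil x hx, fun hm => ?_⟩⟩
    exact hw (w.support_takeUntil_subset_support hx hm)
  exact { preconnected := fun u v => (key u).symm.trans (key v), nonempty := ⟨⟨r, mem_avoidSet_self hr⟩⟩ }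

/-- A path from `v` outside the set to `m` stays outside: up to a vertex `x` of the set it would not
yet have met `m`, and its reversal would lead from `x` to `v`. -/
theorem connected_induce_avoidSet_compl (hG : G.Connected) :
    (G.induce (avoidSet G r m)ᶜ).Connected := by
  classical
  have key : ∀ v : ↥(avoidSet G r m)ᶜ,
      (G.induce (avoidSet G r m)ᶜ).Reachable v ⟨m, notMem_avoidSet⟩ := by
    rintro ⟨v, hv⟩
    obtain ⟨w, hw⟩ := hG.exists_isPath v m
    refine ⟨w.induce (avoidSet G r m)ᶜ fun x hx hxA => ?_⟩
    have hxm : m ≠ x := fun e => notMem_avoidSet (e ▸ hxA)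
    have hmx : m ∉ (w.takeUntil x hx).support :=
      Walk.endpoint_notMem_support_takeUntil hw hx hxm
    refine hv (mem_avoidSet_of_walk hxA (w.takeUntil x hx).reverse ?_)
    rwa [Walk.support_reverse, List.mem_reverse]
  exact { preconnected := fun u v => (key u).trans (key v).symm, nonempty := ⟨⟨m, notMem_avoidSet⟩⟩ }

theorem adj_avoidSet_eq {a b : V} (ha : a ∈ avoidSet G r m) (hb : b ∉ avoidSet G r m)
    (hab : G.Adj a b) : b = m := by
  by_contra hbm
  refine hb (mem_avoidSet_of_walk ha hab.toWalk ?_)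
  have : m ≠ a := fun e => notMem_avoidSet (e ▸ ha)
  simp [Ne.symm hbm, this]

theorem exists_joinedAt_avoidSet (hG : G.IsTree) (hr : r ≠ m) :
    ∃ p, JoinedAt G (avoidSet G r m) p m := by
  classical
  obtain ⟨w⟩ := hG.connected r m
  obtain ⟨⟨⟨p, b⟩, hpb⟩, -, hp, hb⟩ :=
    w.exists_boundary_dart (avoidSet G r m) (mem_avoidSet_self hr) notMem_avoidSet
  simp only at hp hb hpb
  obtain rfl : b = m := adj_avoidSet_eq hp hb hpb
  refine ⟨p, hp, notMem_avoidSet, fun a ha c hc => ⟨fun hac => ?_, ?_⟩⟩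
  · obtain rfl := adj_avoidSet_eq ha hc hac
    refine ⟨?_, rfl⟩
    obtain ⟨u, hu⟩ := ha
    obtain ⟨v, hv⟩ := hp
    -- Two edges from the set into `m` give two paths from `r` to `m`; these coincide in a tree, so
    -- their penultimate vertices agree.
    have h1 : (u.bypass.concat hac).IsPath :=
      u.bypass_isPath.concat (fun h => hu (u.support_bypass_subset_support h)) hac
    have h2 : (v.bypass.concat hpb).IsPath :=
      v.bypass_isPath.concat (fun h => hv (v.support_bypass_subset_support h)) hpb
    have h3 := (hG.existsUnique_path r c).unique h1 h2
    have h4 := congrArg Walk.penultimate h3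
    simpa using h4
  · rintro ⟨rfl, rfl⟩
    exact hpb

end Walks

section Records

variable {V : Type*} [LinearOrder V] {A : Set V} {G : SimpleGraph V} {p m r : V}

/-- Shortcutting a walk to a path only shrinks its support. Records can thus be transported along
arbitrary walks. -/
theorem isRecord_iff_exists_walk (hG : G.IsTree) {v : V} :
    IsRecord G r v ↔ ∃ w : G.Walk r v, ∀ x ∈ w.support, x ≤ v := by
  classical
  constructor
  · intro h
    obtain ⟨w, hw⟩ := hG.connected.exists_isPath r v
    exact ⟨w, h w hw⟩
  · rintro ⟨w, hw⟩ q hq x hx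
    rw [(hG.existsUnique_path r v).unique hq w.bypass_isPath] at hx
    exact hw x (w.support_bypass_subset_support hx)

theorem isRecord_of_forall_le (hm : ∀ v, v ≤ m) : IsRecord G r m := fun _ _ x _ => hm x

theorem setOf_isRecord_of_root_max (hG : G.IsTree) (hm : ∀ v, v ≤ m) :
    {v | IsRecord G m v} = {m} := by
  ext v
  rw [Set.mem_ofPred_eq, Set.mem_singleton_iff, isRecord_iff_exists_walk hG]
  constructor
  · rintro ⟨w, hw⟩
    exact le_antisymm (hm v) (hw m w.start_mem_support)
  · rintro rfl
    exact ⟨Walk.nil, fun x _ => hm x⟩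

theorem JoinedAt.setOf_isRecord (h : JoinedAt G A p m) (hm : ∀ v, v ≤ m) (hG : G.IsTree)
    (hA : (G.induce A).IsTree) (hr : r ∈ A) :
    {v | IsRecord G r v} =
      insert m ((↑) '' {v : A | IsRecord (G.induce A) ⟨r, hr⟩ v}) := by
  ext v
  simp only [Set.mem_ofPred_eq, Set.mem_insert_iff, Set.mem_image, isRecord_iff_exists_walk hG,
    isRecord_iff_exists_walk hA]
  constructor
  · rintro ⟨w, hw⟩
    refine or_iff_not_imp_left.2 fun hvm => ?_
    have hmw : m ∉ w.support := fun hx => hvm (le_antisymm (hm v) (hw m hx))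
    have hs := h.support_subset w hr hmw
    refine ⟨⟨v, hs v w.end_mem_support⟩, ⟨w.induce A hs, fun x hx => ?_⟩, rfl⟩
    rw [Walk.support_induce, List.mem_attachWith] at hx
    exact hw _ hx
  · rintro (rfl | ⟨v, ⟨w, hw⟩, rfl⟩)
    · obtain ⟨w⟩ := hG.connected r v
      exact ⟨w, fun x _ => hm x⟩
    · obtain ⟨q, hq⟩ := exists_walk_of_walk_induce w
      refine ⟨q, fun x hx => ?_⟩
      obtain ⟨y, hy, rfl⟩ := hq x hx
      exact hw y hy

theorem JoinedAt.ncard_isRecord [Finite V] (h : JoinedAt G A p m) (hm : ∀ v, v ≤ m)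
    (hG : G.IsTree) (hA : (G.induce A).IsTree) (hr : r ∈ A) :
    {v | IsRecord G r v}.ncard = {v : A | IsRecord (G.induce A) ⟨r, hr⟩ v}.ncard + 1 := by
  rw [h.setOf_isRecord hm hG hA hr, Set.ncard_insert_of_notMem,
    Set.ncard_image_of_injective _ Subtype.val_injective]
  rintro ⟨x, -, hx⟩
  exact h.right_notMem (hx ▸ x.2)

end Records

end GraphDecomposition

/-! ### Recurrences for trees and for tree records. -/

section Counting

open SimpleGraph

/-- The number of trees on the vertex set `V`. -/
noncomputable def treeCount (V : Type*) : ℕ := {G : SimpleGraph V | G.IsTree}.ncard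

/-- The number of rooted trees on the vertex set `V` whose number of records satisfies `Q`. -/
noncomputable def rootedTreeCount (V : Type*) [LinearOrder V] (Q : ℕ → Prop) : ℕ :=
  {P : SimpleGraph V × V | P.1.IsTree ∧ Q {v | IsRecord P.1 P.2 v}.ncard}.ncard

theorem treeCount_congr {V W : Type*} (e : V ≃ W) : treeCount V = treeCount W := by
  rw [treeCount, treeCount, ← Set.ncard_preimage_of_injective_subset_range e.simpleGraph.injective
    (by rw [e.simpleGraph.surjective.range_eq]; exact Set.subset_univ _)]
  congr 1
  ext G
  exact (Iso.comap e.symm G).isTree_iff.symm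

theorem IsRecord.map_iso {V W : Type*} [LinearOrder V] [LinearOrder W] {G : SimpleGraph V}
    {H : SimpleGraph W} (hG : G.IsTree) (e : V ≃o W) (f : G ≃g H) (hf : ∀ v, f v = e v)
    {r v : V} (h : IsRecord G r v) : IsRecord H (e r) (e v) := by
  obtain ⟨w, hw⟩ := (isRecord_iff_exists_walk hG).1 h
  rw [← hf r, ← hf v, isRecord_iff_exists_walk (f.isTree_iff.1 hG)]
  refine ⟨w.map f.toHom, fun x hx => ?_⟩
  rw [Walk.support_map] at hx
  obtain ⟨y, hy, rfl⟩ := List.mem_map.1 hx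
  change f y ≤ f v
  rw [hf, hf]
  exact e.monotone (hw y hy)

theorem rootedTreeCount_congr {V W : Type*} [LinearOrder V] [LinearOrder W] (e : V ≃o W)
    (Q : ℕ → Prop) : rootedTreeCount V Q = rootedTreeCount W Q := by
  let φ : SimpleGraph V × V ≃ SimpleGraph W × W := e.toEquiv.simpleGraph.prodCongr e.toEquiv
  rw [rootedTreeCount, rootedTreeCount, ← Set.ncard_preimage_of_injective_subset_range φ.injective
    (by rw [φ.surjective.range_eq]; exact Set.subset_univ _)]
  congr 1
  ext ⟨G, r⟩
  let f : (e.toEquiv.simpleGraph G) ≃g G := Iso.comap e.toEquiv.symm G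
  refine (and_congr_right fun hG => ?_).trans (and_congr_left' f.isTree_iff.symm)
  have hrec : {v | IsRecord (e.toEquiv.simpleGraph G) (e r) v} = e '' {v | IsRecord G r v} := by
    ext v
    constructor
    · intro h
      refine ⟨e.symm v, ?_, e.apply_symm_apply v⟩
      have := IsRecord.map_iso (f.isTree_iff.2 hG) e.symm f (fun _ => rfl) h
      rwa [e.symm_apply_apply] at this
    · rintro ⟨v, h, rfl⟩
      exact IsRecord.map_iso hG e f.symm (fun _ => rfl) h
  change Q _ ↔ Q {v | IsRecord (e.toEquiv.simpleGraph G) (e r) v}.ncard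
  rw [hrec, Set.ncard_image_of_injective _ e.injective]

/-- Gluing is a bijection from the triples (rooted tree on `A`, point of `A`, tree on `Aᶜ`). The
shift `k + 1` accounts for the record `m`. The general `Q` serves both the record recurrence and,
with `Q` always true, Cayley's formula. -/
theorem ncard_setOf_avoidSet_eq {V : Type*} [LinearOrder V] [Finite V] {m : V}
    (hm : ∀ v, v ≤ m) {A : Set V} (hA : m ∉ A) (Q : ℕ → Prop) :
    {P : SimpleGraph V × V | (P.1.IsTree ∧ P.2 ≠ m ∧ Q {v | IsRecord P.1 P.2 v}.ncard) ∧
      avoidSet P.1 P.2 m = A}.ncard =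
    rootedTreeCount A (fun k => Q (k + 1)) * A.ncard * treeCount ↥Aᶜ := by
  rw [rootedTreeCount, treeCount, ← Nat.card_coe_set_eq A, ← Set.ncard_univ A, ← Set.ncard_prod,
    ← Set.ncard_prod]
  symm
  refine Set.BijOn.ncard_eq (f := fun x : ((SimpleGraph A × A) × A) × SimpleGraph ↥Aᶜ =>
    (glue A x.1.1.1 x.2 (x.1.2 : V) m, (x.1.1.2 : V))) ⟨?_, ?_, ?_⟩
  · rintro ⟨⟨⟨GA, r⟩, p⟩, GB⟩ ⟨⟨⟨hGA, hQ⟩, -⟩, hGB⟩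
    simp only at hGA hQ hGB
    have hJ : JoinedAt (glue A GA GB p m) A p m := glue_joinedAt p.2 hA
    have hI : (glue A GA GB p m).induce A = GA := glue_induce_left hA
    have hT : (glue A GA GB p m).IsTree := glue_isTree p.2 hA hGA hGB
    refine ⟨⟨hT, fun h => hA (h ▸ r.2), ?_⟩, ?_⟩
    · rw [hJ.ncard_isRecord hm hT (by rwa [hI]) r.2, hI]
      exact hQ
    · exact hJ.avoidSet_eq (by rw [hI]; exact hGA.connected.preconnected) r.2
  · rintro ⟨⟨⟨GA, r⟩, p⟩, GB⟩ - ⟨⟨⟨GA', r'⟩, p'⟩, GB'⟩ - h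
    simp only [Prod.mk.injEq] at h
    obtain ⟨h, hr⟩ := h
    have h1 : GA = GA' := by
      rw [← glue_induce_left (GA := GA) (GB := GB) (p := p) hA, h, glue_induce_left hA]
    have h2 : GB = GB' := by
      rw [← glue_induce_right (GA := GA) (GB := GB) (m := m) p.2, h, glue_induce_right p'.2]
    have h3 : (p : V) = p' := by
      have hJ : JoinedAt (glue A GA GB p m) A p m := glue_joinedAt p.2 hA
      have hJ' : JoinedAt (glue A GA' GB' p' m) A p' m := glue_joinedAt p'.2 hA
      exact ((hJ'.adj_iff p.2 hA).1 (h ▸ (hJ.adj_iff p.2 hA).2 ⟨rfl, rfl⟩)).1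
    simp only [Prod.mk.injEq]
    exact ⟨⟨⟨h1, Subtype.ext hr⟩, Subtype.ext h3⟩, h2⟩
  · rintro ⟨G, r⟩ ⟨⟨hG, hr, hQ⟩, rfl⟩
    simp only at hG hr hQ
    obtain ⟨p, hJ⟩ := exists_joinedAt_avoidSet hG hr
    have hGA : (G.induce (avoidSet G r m)).IsTree :=
      ⟨connected_induce_avoidSet hr, hG.isAcyclic.induce _⟩
    refine ⟨⟨⟨⟨G.induce _, ⟨r, mem_avoidSet_self hr⟩⟩, ⟨p, hJ.left_mem⟩⟩, G.induce _⟩,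
      ⟨⟨⟨hGA, ?_⟩, Set.mem_univ _⟩, ⟨connected_induce_avoidSet_compl hG.connected,
        hG.isAcyclic.induce _⟩⟩, ?_⟩
    · rw [← hJ.ncard_isRecord hm hG hGA]
      exact hQ
    · simp only [hJ.glue_eq]

theorem ncard_setOf_root_ne_last (n : ℕ) (Q : ℕ → Prop) :
    {P : SimpleGraph (Fin (n + 1)) × Fin (n + 1) |
      P.1.IsTree ∧ P.2 ≠ Fin.last n ∧ Q {v | IsRecord P.1 P.2 v}.ncard}.ncard =
    ∑ a ∈ Finset.range (n + 1), n.choose a *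
      (rootedTreeCount (Fin a) (fun k => Q (k + 1)) * a * treeCount (Fin (n + 1 - a))) := by
  classical
  set S : Set (SimpleGraph (Fin (n + 1)) × Fin (n + 1)) :=
    {P | P.1.IsTree ∧ P.2 ≠ Fin.last n ∧ Q {v | IsRecord P.1 P.2 v}.ncard} with hS
  let g : SimpleGraph (Fin (n + 1)) × Fin (n + 1) → Finset (Fin (n + 1)) :=
    fun P => (avoidSet P.1 P.2 (Fin.last n)).toFinset
  rw [Set.ncard_eq_toFinset_card' S, Finset.card_eq_sum_card_fiberwise (f := g)
    (t := (Finset.univ.erase (Fin.last n)).powerset)]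
  · have key : ∀ A ∈ (Finset.univ.erase (Fin.last n)).powerset,
        (S.toFinset.filter fun P => g P = A).card =
        rootedTreeCount (Fin A.card) (fun k => Q (k + 1)) * A.card *
          treeCount (Fin (n + 1 - A.card)) := by
      intro A hA
      have hmA : Fin.last n ∉ (A : Set (Fin (n + 1))) := fun h =>
        (Finset.mem_erase.1 (Finset.mem_powerset.1 hA h)).1 rfl
      have h1 := ncard_setOf_avoidSet_eq (fun v => Fin.le_last v) hmA Q
      have h3 : rootedTreeCount ↥(A : Set (Fin (n + 1))) (fun k => Q (k + 1)) =
          rootedTreeCount (Fin A.card) (fun k => Q (k + 1)) :=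
        (rootedTreeCount_congr (A.orderIsoOfFin rfl) _).symm
      have h2 : treeCount ↥(A : Set (Fin (n + 1)))ᶜ = treeCount (Fin (n + 1 - A.card)) := by
        refine treeCount_congr (Finite.equivFinOfCardEq ?_)
        rw [Nat.card_coe_set_eq, Set.ncard_compl, Set.ncard_coe_finset, Nat.card_eq_fintype_card,
          Fintype.card_fin]
      rw [Set.ncard_coe_finset, h2, h3] at h1
      rw [← h1, ← Set.ncard_coe_finset]
      congr 1
      ext P
      simp only [Finset.coe_filter, Set.mem_toFinset, g, hS, Set.mem_ofPred_eq]
      refine and_congr_right fun _ => ?_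
      rw [← Finset.coe_inj, Set.coe_toFinset]
    rw [Finset.sum_congr rfl key, Finset.sum_powerset_apply_card
      (fun a => rootedTreeCount (Fin a) (fun k => Q (k + 1)) * a * treeCount (Fin (n + 1 - a)))]
    simp
  · intro P _
    simp only [g, Finset.coe_powerset, Set.mem_preimage, Set.mem_powerset_iff, Set.coe_toFinset]
    intro v hv
    simp only [Finset.coe_erase, Finset.coe_univ, Set.mem_sdiff, Set.mem_univ, true_and,
      Set.mem_singleton_iff]
    exact fun h => notMem_avoidSet (h ▸ hv)

theorem rootedTreeCount_true (n : ℕ) :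
    rootedTreeCount (Fin n) (fun _ => True) = treeCount (Fin n) * n := by
  have h : n = (Set.univ : Set (Fin n)).ncard := by rw [Set.ncard_univ, Nat.card_fin]
  conv_rhs => rhs; rw [h]
  rw [treeCount, ← Set.ncard_prod, rootedTreeCount]
  congr 1

theorem ncard_isTree_root_eq {V : Type*} (m : V) :
    {P : SimpleGraph V × V | P.1.IsTree ∧ P.2 = m}.ncard = treeCount V := by
  rw [treeCount, ← mul_one ({G : SimpleGraph V | G.IsTree}.ncard), ← Set.ncard_singleton m,
    ← Set.ncard_prod]
  congr 1

theorem treeCount_recurrence (n : ℕ) :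
    n * treeCount (Fin (n + 1)) = ∑ a ∈ Finset.range (n + 1),
      n.choose a * (treeCount (Fin a) * a * a * treeCount (Fin (n + 1 - a))) := by
  have h := ncard_setOf_root_ne_last n fun _ => True
  simp only [rootedTreeCount_true, and_true] at h
  rw [← h]
  have h1 := ncard_isTree_root_eq (Fin.last n)
  have h2 := rootedTreeCount_true (n + 1)
  have h3 : {P : SimpleGraph (Fin (n + 1)) × Fin (n + 1) | P.1.IsTree ∧ P.2 = Fin.last n} ∪
      {P | P.1.IsTree ∧ P.2 ≠ Fin.last n} = {P | P.1.IsTree ∧ True} := by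
    ext P
    simp only [Set.mem_union, Set.mem_ofPred_eq]
    tauto
  rw [rootedTreeCount, ← h3, Set.ncard_union_eq, h1] at h2
  · linarith
  · rw [Set.disjoint_left]
    exact fun P hP hP' => hP'.2 hP.2

theorem treeRecordNumber_one (n : ℕ) : treeRecordNumber (n + 1) 1 = treeCount (Fin (n + 1)) := by
  rw [← ncard_isTree_root_eq (Fin.last n), treeRecordNumber]
  congr 1
  ext ⟨G, r⟩
  refine and_congr_right fun hG => ?_
  constructor
  · intro h
    obtain ⟨x, hx⟩ := Set.ncard_eq_one.1 h
    have h1 : r ∈ {v | IsRecord G r v} := (isRecord_iff_exists_walk hG).2 ⟨Walk.nil, by simp⟩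
    have h2 : Fin.last n ∈ {v | IsRecord G r v} := isRecord_of_forall_le Fin.le_last
    rw [hx] at h1 h2
    exact h1.trans h2.symm
  · rintro rfl
    simp only
    rw [setOf_isRecord_of_root_max hG Fin.le_last, Set.ncard_singleton]

theorem treeRecordNumber_succ_succ (n k : ℕ) :
    treeRecordNumber (n + 1) (k + 2) = ∑ a ∈ Finset.range (n + 1),
      n.choose a * (treeRecordNumber a (k + 1) * a * treeCount (Fin (n + 1 - a))) := by
  have h := ncard_setOf_root_ne_last n (· = k + 2)
  simp only [rootedTreeCount,
    show ∀ i, i + 1 = k + 2 ↔ i = k + 1 from fun i => by omega] at h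
  refine Eq.trans ?_ h
  rw [treeRecordNumber]
  congr 1
  ext ⟨G, r⟩
  refine and_congr_right fun hG => ⟨fun h => ⟨?_, h⟩, fun h => h.2⟩
  rintro rfl
  simp only [setOf_isRecord_of_root_max hG Fin.le_last, Set.ncard_singleton] at h
  omega

end Counting

/-! ### Abel's binomial identity. -/

section Abel

open Finset Polynomial

/-- This is the vanishing of the difference of order `n + 2` of `x ^ (n + 1)` at `0`, with the signs
absorbed into the powers. It supplies the constant term in Abel's identity. -/
theorem sum_choose_mul_neg_pow_eq_zero (n : ℕ) :
    ∑ k ∈ range (n + 2), ((n + 2).choose (k + 1) : ℝ) * ((k : ℝ) + 1) ^ k *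
      (0 - ((k : ℝ) + 1)) ^ (n + 1 - k) = 0 := by
  have h := congrFun (fwdDiff_iter_pow_eq_zero_of_lt (R := ℝ) (Nat.lt_succ_self (n + 1))) 0
  rw [fwdDiff_iter_eq_sum_shift, sum_range_succ'] at h
  simp only [zero_add, nsmul_eq_mul, mul_one, Nat.cast_zero, ne_eq, Nat.add_eq_zero_iff, one_ne_zero,
    and_false, not_false_eq_true, zero_pow, smul_zero, add_zero, Pi.zero_apply] at h
  refine (sum_congr rfl fun k hk => ?_).trans h
  have hk : k ≤ n + 1 := by rw [mem_range] at hk; omega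
  have e : n + 1 + 1 - (k + 1) = n + 1 - k := by omega
  rw [zsmul_eq_mul, e, zero_sub, neg_pow]
  push_cast
  have : ((k : ℝ) + 1) ^ (n + 1) = (k + 1) ^ k * (k + 1) ^ (n + 1 - k) := by
    rw [← pow_add]; congr 1; omega
  rw [this]
  ring

/-- A case of Abel's binomial identity. -/
theorem abel_polynomial (n : ℕ) :
    ∑ k ∈ range (n + 1), C (((n + 1).choose (k + 1) : ℝ) * ((k : ℝ) + 1) ^ k) *
      (X - C ((k : ℝ) + 1)) ^ (n - k) = C ((n : ℝ) + 1) * X ^ n := by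
  induction n with
  | zero => simp
  | succ n ih =>
    rw [← sub_eq_zero]
    set P := ∑ k ∈ range (n + 1 + 1), C (((n + 1 + 1).choose (k + 1) : ℝ) * ((k : ℝ) + 1) ^ k) *
      (X - C ((k : ℝ) + 1)) ^ (n + 1 - k) - C (((n + 1 : ℕ) : ℝ) + 1) * X ^ (n + 1) with hP
    -- Differentiating each side yields `n + 2` times the identity for `n`, so the difference `P` is
    -- constant; its value at `0` then decides.
    have hd : derivative P = 0 := by
      rw [hP, derivative_sub, derivative_sum, derivative_C_mul, derivative_X_pow, sum_range_succ]
      have : ∀ k ∈ range (n + 1), derivative (C (((n + 1 + 1).choose (k + 1) : ℝ) *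
          ((k : ℝ) + 1) ^ k) * (X - C ((k : ℝ) + 1)) ^ (n + 1 - k)) =
          C ((n : ℝ) + 2) * (C (((n + 1).choose (k + 1) : ℝ) * ((k : ℝ) + 1) ^ k) *
            (X - C ((k : ℝ) + 1)) ^ (n - k)) := by
        intro k hk
        have hk : k ≤ n := by rw [mem_range] at hk; omega
        have e : n + 1 - k = n - k + 1 := by omega
        have hc : ((n + 1 + 1).choose (k + 1) : ℝ) * (((n - k : ℕ) : ℝ) + 1) =
            ((n : ℝ) + 2) * ((n + 1).choose (k + 1) : ℝ) := by
          have := Nat.choose_mul_succ_eq (n + 1) (k + 1)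
          rw [show n + 1 + 1 - (k + 1) = n - k + 1 by omega] at this
          have h' := congrArg (Nat.cast (R := ℝ)) this
          push_cast at h'
          linarith
        rw [e, derivative_C_mul, derivative_X_sub_C_pow, Nat.add_sub_cancel, ← mul_assoc,
          ← mul_assoc, ← C_mul, ← C_mul]
        congr 2
        push_cast
        linear_combination ((k : ℝ) + 1) ^ k * hc
      rw [sum_congr rfl this, ← mul_sum, ih, Nat.sub_self, pow_zero, mul_one, derivative_C,
        add_zero, Nat.add_sub_cancel]
      simp only [← mul_assoc, ← C_mul, ← sub_mul, ← C_sub]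
      push_cast
      rw [show ((n : ℝ) + 2) * (n + 1) - (n + 1 + 1) * (n + 1) = 0 by ring, C_0, zero_mul]
    have h0 : P.eval 0 = 0 := by
      rw [hP, eval_sub, eval_finsetSum]
      simp only [eval_mul, eval_C, eval_pow, eval_sub, eval_X]
      rw [sum_choose_mul_neg_pow_eq_zero]
      simp
    rw [eq_C_of_natDegree_eq_zero (derivative_eq_zero.1 hd),
      coeff_zero_eq_eval_zero, h0, C_0]

/-- Abel's identity at `n + 1`, with the term `k = n`, equal to `(n + 1) ^ n`, moved to the right.
-/
theorem sum_choose_mul_pow_mul_pow (n : ℕ) :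
    ∑ k ∈ range n, ((n + 1).choose (k + 1) : ℝ) * ((k : ℝ) + 1) ^ k * ((n : ℝ) - k) ^ (n - k) =
      n * ((n : ℝ) + 1) ^ n := by
  have h := congrArg (eval ((n : ℝ) + 1)) (abel_polynomial n)
  rw [eval_finsetSum, sum_range_succ] at h
  simp only [eval_mul, eval_C, eval_pow, eval_sub, eval_X, Nat.sub_self, pow_zero, mul_one,
    Nat.choose_self, Nat.cast_one, one_mul, add_sub_add_right_eq_sub] at h
  linarith

end Abel

/-! ### Cayley's formula and the generating functions. -/

section Series

open Finset Polynomial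

theorem treeCount_one : treeCount (Fin 1) = 1 := by
  have h : {G : SimpleGraph (Fin 1) | G.IsTree} = {⊥} := by
    ext G
    rw [Set.mem_singleton_iff, Subsingleton.elim G ⊥, eq_self, iff_true]
    exact SimpleGraph.IsTree.of_subsingleton
  rw [treeCount, h, Set.ncard_singleton]

/-- Cayley's formula, for rooted trees. -/
theorem treeCount_mul (n : ℕ) :
    (treeCount (Fin (n + 1)) : ℝ) * ((n : ℝ) + 1) = ((n : ℝ) + 1) ^ n := by
  induction n using Nat.strong_induction_on with
  | _ n ih =>
  rcases Nat.eq_zero_or_pos n with rfl | hn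
  · simp [treeCount_one]
  have h := congrArg (Nat.cast (R := ℝ)) (treeCount_recurrence n)
  rw [sum_range_succ'] at h
  push_cast at h
  rw [mul_zero, zero_mul, mul_zero, add_zero] at h
  have hn' : (n : ℝ) ≠ 0 := by positivity
  refine mul_left_cancel₀ hn' ?_
  rw [← sum_choose_mul_pow_mul_pow n, ← sum_range_reflect]
  calc (n : ℝ) * (treeCount (Fin (n + 1)) * (n + 1))
      = (n + 1) * (n * treeCount (Fin (n + 1))) := by ring
    _ = _ := by
      rw [h, mul_sum]
      refine sum_congr rfl fun k hk => ?_
      rw [mem_range] at hk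
      obtain ⟨l, rfl⟩ : ∃ l, n = k + l + 1 := ⟨n - k - 1, by omega⟩
      have h1 := ih k (by omega)
      have h2 := ih l (by omega)
      -- The extra factor `n + 1` raises the binomial coefficient to that of Abel's sum and leaves
      -- the factor `l + 1`, which completes `treeCount (Fin (l + 1))` to the form needed by the
      -- induction hypothesis.
      have h3 : ((k + l + 1).choose (k + 1) : ℝ) * ((k : ℝ) + l + 1 + 1) =
          ((k + l + 1 + 1).choose (l + 1) : ℝ) * (l + 1) := by
        have h4 := Nat.choose_mul_succ_eq (k + l + 1) (k + 1)
        rw [show k + l + 1 + 1 - (k + 1) = l + 1 by omega,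
          Nat.choose_symm_of_eq_add (show k + l + 1 + 1 = (k + 1) + (l + 1) by ring)] at h4
        exact_mod_cast h4
      rw [show k + l + 1 - k = l + 1 by omega, show k + l + 1 - 1 - k = l by omega,
        show k + l + 1 - l = k + 1 by omega]
      have e : ((k + l + 1 : ℕ) : ℝ) - l = k + 1 := by push_cast; ring
      rw [e, pow_succ, ← h1, ← h2]
      push_cast
      linear_combination (treeCount (Fin (k + 1)) * (k + 1) * (k + 1) * treeCount (Fin (l + 1)) : ℝ)
        * h3

/-- The quotient of the tree function by the variable. -/
noncomputable def treeSeries : PowerSeries ℝ[X] :=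
  PowerSeries.mk fun n => C ((treeCount (Fin (n + 1)) : ℝ) / (n.factorial : ℝ))

/-- The derivative of the generating function of rooted trees with `j` records. -/
noncomputable def treeRecordDerivSeries (j : ℕ) : PowerSeries ℝ[X] :=
  PowerSeries.mk fun n => monomial j ((treeRecordNumber (n + 1) j : ℝ) / (n.factorial : ℝ))

theorem X_mul_treeSeries : PowerSeries.X * treeSeries = cayleyTreeFunction := by
  ext1 n
  rcases n with _ | n
  · simp [cayleyTreeFunction]
  · rw [PowerSeries.coeff_succ_X_mul, treeSeries, cayleyTreeFunction, PowerSeries.coeff_mk,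
      PowerSeries.coeff_mk, if_neg n.succ_ne_zero, Nat.add_sub_cancel, Nat.factorial_succ]
    have : (n.factorial : ℝ) ≠ 0 := by positivity
    congr 1
    push_cast
    rw [← treeCount_mul]
    field_simp

theorem treeRecordDerivSeries_one :
    treeRecordDerivSeries 1 = PowerSeries.C (X : ℝ[X]) * treeSeries := by
  ext1 n
  rw [PowerSeries.coeff_C_mul, treeSeries, treeRecordDerivSeries, PowerSeries.coeff_mk,
    PowerSeries.coeff_mk, treeRecordNumber_one, X_mul_C, C_mul_X_eq_monomial]

/-- The binomial sum is a product of exponential series. The factor `a`, for the choice of `p`,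
cancels against `a!`, which is why `z` times the derivative appears; the term `a = 0` vanishes on
both sides. -/
theorem treeRecordDerivSeries_succ (j : ℕ) :
    treeRecordDerivSeries (j + 2) = (PowerSeries.X * treeRecordDerivSeries (j + 1)) *
      (PowerSeries.C (X : ℝ[X]) * treeSeries) := by
  ext1 n
  rw [PowerSeries.coeff_mul, Nat.sum_antidiagonal_eq_sum_range_succ_mk, treeRecordDerivSeries,
    PowerSeries.coeff_mk, treeRecordNumber_succ_succ, Nat.cast_sum, sum_div, map_sum]
  refine sum_congr rfl fun a ha => ?_
  rw [mem_range] at ha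
  rw [PowerSeries.coeff_C_mul, treeSeries, PowerSeries.coeff_mk, X_mul_C, C_mul_X_eq_monomial]
  rcases a with _ | a
  · simp
  · obtain ⟨l, rfl⟩ : ∃ l, n = a + 1 + l := ⟨n - (a + 1), by omega⟩
    rw [PowerSeries.coeff_succ_X_mul, treeRecordDerivSeries, PowerSeries.coeff_mk,
      monomial_mul_monomial, Nat.add_sub_cancel_left, Nat.cast_mul, Nat.cast_add_choose,
      show a + 1 + l + 1 - (a + 1) = l + 1 by omega, Nat.factorial_succ a]
    congr 1
    have h1 : ((a + 1 + l).factorial : ℝ) ≠ 0 := by positivity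
    have h2 : (a.factorial : ℝ) ≠ 0 := by positivity
    have h3 : (l.factorial : ℝ) ≠ 0 := by positivity
    push_cast
    field_simp

theorem X_mul_treeRecordDerivSeries (j : ℕ) :
    PowerSeries.X * treeRecordDerivSeries (j + 1) =
      (PowerSeries.C (X : ℝ[X]) * cayleyTreeFunction) ^ (j + 1) := by
  induction j with
  | zero =>
    rw [zero_add, treeRecordDerivSeries_one, pow_one, ← X_mul_treeSeries, mul_left_comm]
  | succ j ih =>
    rw [treeRecordDerivSeries_succ, pow_succ, ← ih, ← X_mul_treeSeries]
    ring

theorem treeRecordNumber_zero_succ (j : ℕ) : treeRecordNumber 0 (j + 1) = 0 := by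
  rw [treeRecordNumber, Set.ncard_eq_zero]
  ext P
  exact P.2.elim0

theorem treeRecordSeries_eq_formalIntegral (j : ℕ) :
    treeRecordSeries (j + 1) = formalIntegral (treeRecordDerivSeries (j + 1)) := by
  ext1 n
  rw [treeRecordSeries, formalIntegral, PowerSeries.coeff_mk, PowerSeries.coeff_mk]
  rcases n with _ | n
  · simp [treeRecordNumber_zero_succ]
  · simp only
    rw [treeRecordDerivSeries, PowerSeries.coeff_mk, smul_monomial, Nat.factorial_succ, smul_eq_mul]
    congr 1
    push_cast
    have : (n.factorial : ℝ) ≠ 0 := by positivity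
    field_simp

end Series

end TreeRecords


theorem mainTheorem6 (j : ℕ) (hj : 1 ≤ j) :
    ∃ g : PowerSeries (Polynomial ℝ),
      PowerSeries.X * g =
        (PowerSeries.C (Polynomial.X : Polynomial ℝ) * TreeRecords.cayleyTreeFunction) ^ j ∧
      TreeRecords.treeRecordSeries j = TreeRecords.formalIntegral g := by
  obtain ⟨i, rfl⟩ := Nat.exists_eq_add_of_le' hj
  exact ⟨TreeRecords.treeRecordDerivSeries (i + 1), TreeRecords.X_mul_treeRecordDerivSeries i,
    TreeRecords.treeRecordSeries_eq_formalIntegral i⟩
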